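/- Conventions. For a unital C*-algebra $B$ and $x,y\in B$ write $x\simeq_a y$ (approximate unitary equivalence in $B$) if there is a sequence of unitaries $u_k\in B$ with $u_k^*xu_k\to y$ in norm. For $a\in A$ and $n\ge 1$ let $a^{(n)}=1_{M_n}\otimes a\in M_n(A)$ be the $n$-fold direct sum of $a$ with itself; $a^{(n)}\simeq_a b^{(n)}$ refers to unitaries in $M_n(A)$. A UHF algebra is a unital C*-algebra that is the closure of the union of an increasing sequence of unital *-subalgebras isomorphic to full matrix algebras $M_{k_i}(\mathbb C)$, $k_i\ge 1$; its supernatural number assigns to each prime $p$ the supremum over $i$ of the exponent of $p$ in $k_i$. Let $\mathcal Q$ be the universal UHF algebra (the one whose supernatural number is divisible by every positive integer, i.e. every prime has exponent $\infty$), and for $n\ge 1$ let $M_{n^\infty}$ be the UHF algebra with supernatural number $n^\infty$ (exponent $\infty$ at the primes dividing $n$, and $0$ at all others). For a UHF algebra $D$, a C*-algebra $A$ is called $D$-stable if $A\otimes D\cong A$, where $\otimes$ is the minimal tensor product. Statement. Let $A$ be a unital separable C*-algebra and let $a,b\in A$. (i) If $A$ is $\mathcal Q$-stable, then the following are equivalent: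 (1) $a\simeq_a b$ in $A$; (2) $a^{(n)}\simeq_a b^{(n)}$ in $M_n(A)$ for all $n\ge 1$; (3) $a^{(n)}\simeq_a b^{(n)}$ in $M_n(A)$ for some $n\ge 1$. (ii) Let $m,n\ge 1$ with $m\mid n$. If $A$ is $M_{n^\infty}$-stable, then $a^{(m)}\simeq_a b^{(m)}$ in $M_m(A)$ if and only if $a\simeq_a b$ in $A$. -/

import Mathlib

open Filter Topology
open scoped TensorProduct

universe u v

noncomputable section

/-! ### Approximate unitary equivalence and matrix amplifications -/

/-- `a ≃ₐ b` in `B`: there is a sequence of unitaries `uₖ` of `B` with `uₖ* a uₖ → b`. For a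
C⋆-algebra `B` the topology is the norm topology. (For `CStarMatrix n n A` Mathlib's topology is,
definitionally, the one of the C⋆-norm.) -/
def ApproxUnitarilyEquiv {B : Type*} [Monoid B] [StarMul B] [TopologicalSpace B] (a b : B) : Prop :=
  ∃ u : ℕ → unitary B, Tendsto (fun k => star (u k : B) * a * (u k : B)) atTop (𝓝 b)

/-- The amplification `a⁽ⁿ⁾ = 1 ⊗ a`, the `n`-fold direct sum of `a` in the C⋆-algebra `Mₙ(A)`. -/
def amplification {A : Type*} [Zero A] (n : ℕ) (a : A) : CStarMatrix (Fin n) (Fin n) A :=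
  CStarMatrix.ofMatrix (Matrix.diagonal fun _ => a)

/-! ### UHF algebras -/

/-- Supernatural numbers `∏ p ^ N p`, as the family of their exponents `N p ∈ {0, 1, …, ∞}`. -/
abbrev Supernatural : Type := Nat.Primes → ℕ∞

/-- The supernatural number `n^∞`. -/
def Supernatural.powTop (n : ℕ) : Supernatural :=
  fun p => if (p : ℕ) ∣ n then ⊤ else 0

/-- `D` is a UHF algebra with supernatural number `N`: it is the norm closure of an increasing
union of unital ⋆-subalgebras `B i ≅ M_{k i}(ℂ)`, and the exponent of each prime `p` in `N` is the
supremum of its exponents in the `k i`. -/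
def IsUHF (D : Type*) [CStarAlgebra D] (N : Supernatural) : Prop :=
  ∃ (k : ℕ → ℕ) (B : ℕ → StarSubalgebra ℂ D),
    (∀ i, 0 < k i) ∧
    Monotone B ∧
    (∀ i, Nonempty (B i ≃⋆ₐ[ℂ] Matrix (Fin (k i)) (Fin (k i)) ℂ)) ∧
    Dense (⋃ i, (B i : Set D)) ∧
    ∀ p : Nat.Primes, ⨆ i, (padicValNat p (k i) : ℕ∞) = N p

/-- `D` is the UHF algebra `M_{n^∞}`. -/
def IsUHFPow (D : Type*) [CStarAlgebra D] (n : ℕ) : Prop :=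
  IsUHF D (Supernatural.powTop n)

/-- `Q` is the universal UHF algebra: its supernatural number is divisible by every integer, that
is, every prime has exponent `∞` in it. -/
def IsUniversalUHF (Q : Type*) [CStarAlgebra Q] : Prop :=
  IsUHF Q (fun _ => ⊤)

/-! ### The minimal (spatial) tensor product -/

/-- The Hilbert space tensor product of `H` and `K`: the completion of the algebraic tensor
product with the inner product `⟪x ⊗ y, x' ⊗ y'⟫ = ⟪x, x'⟫ * ⟪y, y'⟫`. -/
def HilbertTensor (H K : Type*)
    [NormedAddCommGroup H] [InnerProductSpace ℂ H]
    [NormedAddCommGroup K] [InnerProductSpace ℂ K] : Type _ :=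
  UniformSpace.Completion (H ⊗[ℂ] K)

section Operators

variable {H K : Type*}
  [NormedAddCommGroup H] [InnerProductSpace ℂ H] [NormedAddCommGroup K] [InnerProductSpace ℂ K]

instance : NormedAddCommGroup (HilbertTensor H K) :=
  inferInstanceAs (NormedAddCommGroup (UniformSpace.Completion (H ⊗[ℂ] K)))

instance : InnerProductSpace ℂ (HilbertTensor H K) :=
  inferInstanceAs (InnerProductSpace ℂ (UniformSpace.Completion (H ⊗[ℂ] K)))

instance : CompleteSpace (HilbertTensor H K) :=
  inferInstanceAs (CompleteSpace (UniformSpace.Completion (H ⊗[ℂ] K)))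

/-- The canonical map of the algebraic tensor product into the Hilbert space tensor product. -/
def HilbertTensor.of (z : H ⊗[ℂ] K) : HilbertTensor H K :=
  (z : UniformSpace.Completion (H ⊗[ℂ] K))

/-- The operator `S ⊗ T` on the Hilbert space tensor product. -/
def tensorOp (S : H →L[ℂ] H) (T : K →L[ℂ] K) : HilbertTensor H K →L[ℂ] HilbertTensor H K :=
  show UniformSpace.Completion (H ⊗[ℂ] K) →L[ℂ] UniformSpace.Completion (H ⊗[ℂ] K) from
    (TensorProduct.mapL S T).completion

theorem tensorOp_of_tmul (S : H →L[ℂ] H) (T : K →L[ℂ] K) (x : H) (y : K) :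
    tensorOp S T (HilbertTensor.of (x ⊗ₜ[ℂ] y)) = HilbertTensor.of (S x ⊗ₜ[ℂ] T y) :=
  ((TensorProduct.mapL S T).completion_apply_coe _).trans
    (congrArg _ (TensorProduct.mapL_tmul S T x y))

end Operators

section Spatial

variable {H K : Type*}
  [NormedAddCommGroup H] [InnerProductSpace ℂ H] [CompleteSpace H]
  [NormedAddCommGroup K] [InnerProductSpace ℂ K] [CompleteSpace K]
  {A D : Type*} [CStarAlgebra A] [CStarAlgebra D]

/-- The spatial tensor product of `A` and `D` formed in the unital representations `π`, `σ`: the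
C⋆-algebra of operators on the Hilbert space tensor product that is generated by the operators
`π a ⊗ σ d`. If `π` and `σ` are faithful, this is the minimal tensor product of `A` and `D`. -/
def spatialTensor (π : A →⋆ₐ[ℂ] (H →L[ℂ] H)) (σ : D →⋆ₐ[ℂ] (K →L[ℂ] K)) :
    StarSubalgebra ℂ (HilbertTensor H K →L[ℂ] HilbertTensor H K) :=
  (StarAlgebra.adjoin ℂ {T | ∃ (a : A) (d : D), T = tensorOp (π a) (σ d)}).topologicalClosure

end Spatial

/-- `A` is `D`-stable: `A ⊗ D ≅ A`, where `⊗` is the minimal tensor product, that is, the spatial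
tensor product in faithful representations (up to isomorphism it does not depend on their choice,
and every C⋆-algebra has a faithful representation on a Hilbert space of its own universe). -/
def IsStableUnder (A : Type u) (D : Type v) [CStarAlgebra A] [CStarAlgebra D] : Prop :=
  ∃ (H : Type u) (_ : NormedAddCommGroup H) (_ : InnerProductSpace ℂ H) (_ : CompleteSpace H)
    (K : Type v) (_ : NormedAddCommGroup K) (_ : InnerProductSpace ℂ K) (_ : CompleteSpace K)
    (π : A →⋆ₐ[ℂ] (H →L[ℂ] H)) (σ : D →⋆ₐ[ℂ] (K →L[ℂ] K)),
    Function.Injective π ∧ Function.Injective σ ∧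
      Nonempty (spatialTensor π σ ≃⋆ₐ[ℂ] A)

end

/-! The point is to undo an amplification. Suppose `A` is the closure of increasing ⋆-subalgebras `S
i`, each commuting with a system `g` of `n × n` matrix units of `A` (`HasApproxCentralMatrixUnits`).
On matrices with entries commuting with `g`, the map `x ↦ ∑ xᵢⱼ gᵢⱼ` is a unital ⋆-homomorphism, and
it sends `1 ⊗ a` to `a`. Perturb unitaries conjugating `1 ⊗ a` towards `1 ⊗ b` so that their entries
lie in some `S i`, then contract: the results are almost unitary and conjugate `a` towards `b`.
Polar decomposition makes them unitary (`ApproxUnitarilyEquiv.of_amplification`).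

Such units exist in a UHF algebra when every prime dividing `n` has exponent `∞`: the commutant of
`M_k` in a later `M_l` is `M_{l/k}`, and `n ∣ l/k` for late enough `l`. The embedding `d ↦ 1 ⊗ d`
carries them to the spatial tensor product, and the isomorphism given by stability carries them to
`A`. -/

/-! ### Almost unitary elements and polar decomposition -/

section Polar

variable {A : Type*} [CStarAlgebra A]

attribute [local instance] CStarAlgebra.spectralOrder CStarAlgebra.spectralOrderedRing

/-- The unitary part of the polar decomposition of an invertible element. -/
theorem mul_rpow_star_mul_self_mem_unitary {w : A} (h₁ : IsUnit (star w * w))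
    (h₂ : IsUnit (w * star w)) : w * (star w * w) ^ (-(1 / 2) : ℝ) ∈ unitary A := by
  have hpos : (0 : A) ≤ star w * w := star_mul_self_nonneg w
  set p := star w * w with hp
  set h := p ^ (-(1 / 2) : ℝ) with hh
  have hstar : star h = h := (CFC.rpow_nonneg (a := p)).isSelfAdjoint.star_eq
  have hhp : h * p = p ^ (1 / 2 : ℝ) := by
    conv_lhs => arg 2; rw [← CFC.rpow_one p]
    rw [hh, ← CFC.rpow_add h₁]
    norm_num
  have hinv : p ^ (1 / 2 : ℝ) * h = 1 := by
    rw [hh, ← CFC.rpow_add h₁, add_neg_cancel, CFC.rpow_zero p]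
  have hinv' : h * p ^ (1 / 2 : ℝ) = 1 := by
    rw [hh, ← CFC.rpow_add h₁, neg_add_cancel, CFC.rpow_zero p]
  have hleft : star (w * h) * (w * h) = 1 := by
    rw [star_mul, hstar]
    calc h * star w * (w * h) = h * p * h := by simp only [hp, mul_assoc]
      _ = 1 := by rw [hhp, hinv]
  -- Invertibility of `w * star w` supplies a right inverse of `w * h`, which must equal the left
  -- inverse `star (w * h)`.
  obtain ⟨s, hs⟩ := h₂.exists_right_inv
  have hright : w * h * (p ^ (1 / 2 : ℝ) * star w * s) = 1 := by
    calc _ = w * (h * p ^ (1 / 2 : ℝ)) * star w * s := by simp only [mul_assoc]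
      _ = 1 := by rw [hinv', mul_one, hs]
  refine ⟨hleft, ?_⟩
  rw [left_inv_eq_right_inv hleft hright]
  exact hright

theorem tendsto_rpow_one {x : ℕ → A} (hx : ∀ k, 0 ≤ x k) (h : Tendsto x atTop (𝓝 1)) (r : ℝ) :
    Tendsto (fun k => x k ^ r) atTop (𝓝 1) := by
  have hone : IsStrictlyPositive (1 : A) := isStrictlyPositive_one
  have hc := CFC.continuousOn_rpow (A := A) r 1 hone
  have hu : ∀ᶠ k in atTop, IsUnit (x k) := h.eventually (Units.isOpen.mem_nhds isUnit_one)
  have := hc.tendsto.comp (tendsto_nhdsWithin_iff.2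
    ⟨h, hu.mono fun k hk => hk.isStrictlyPositive (hx k)⟩)
  simpa [Function.comp_def] using this

/-- The polar correction `(w* w)^(-1/2)` tends to `1`, so passing to the unitary part does not
change the limit. -/
theorem ApproxUnitarilyEquiv.of_tendsto {a b : A} {w : ℕ → A}
    (h₁ : Tendsto (fun k => star (w k) * w k) atTop (𝓝 1))
    (h₂ : Tendsto (fun k => w k * star (w k)) atTop (𝓝 1))
    (h₃ : Tendsto (fun k => star (w k) * a * w k) atTop (𝓝 b)) : ApproxUnitarilyEquiv a b := by
  classical
  let h : ℕ → A := fun k => (star (w k) * w k) ^ (-(1 / 2) : ℝ)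
  have hh : Tendsto h atTop (𝓝 1) :=
    tendsto_rpow_one (fun k => star_mul_self_nonneg (w k)) h₁ _
  have hstar : ∀ k, star (h k) = h k := fun k => (CFC.rpow_nonneg).isSelfAdjoint.star_eq
  have hu : ∀ᶠ k in atTop, w k * h k ∈ unitary A := by
    filter_upwards [h₁.eventually (Units.isOpen.mem_nhds isUnit_one),
      h₂.eventually (Units.isOpen.mem_nhds isUnit_one)] with k hk₁ hk₂
    exact mul_rpow_star_mul_self_mem_unitary hk₁ hk₂
  -- The default `1` is used for at most finitely many `k`.
  refine ⟨fun k => if hk : w k * h k ∈ unitary A then ⟨_, hk⟩ else 1, ?_⟩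
  have hlim : Tendsto (fun k => h k * (star (w k) * a * w k) * h k) atTop (𝓝 b) := by
    simpa using (hh.mul h₃).mul hh
  refine hlim.congr' (hu.mono fun k hk => ?_)
  simp only [dif_pos hk, star_mul, hstar, mul_assoc]

end Polar

/-! ### Matrix units -/

/-- A system of matrix units of the unital `⋆`-algebra `R`, indexed by `ι`. -/
structure IsMatrixUnits {ι R : Type*} [Fintype ι] [DecidableEq ι] [Semiring R] [StarRing R]
    (g : ι → ι → R) : Prop where
  star_eq : ∀ i j, star (g i j) = g j i
  mul_eq : ∀ i j k l, g i j * g k l = if j = k then g i l else 0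
  sum_diag : ∑ i, g i i = 1

namespace IsMatrixUnits

variable {ι κ R S : Type*} [Fintype ι] [DecidableEq ι] [Fintype κ] [DecidableEq κ]

section Ring

variable [Semiring R] [StarRing R] [Semiring S] [StarRing S] {g : ι → ι → R}

theorem map (hg : IsMatrixUnits g) {F : Type*} [FunLike F R S] [RingHomClass F R S]
    [StarHomClass F R S] (φ : F) : IsMatrixUnits fun i j => φ (g i j) where
  star_eq i j := by rw [← map_star, hg.star_eq]
  mul_eq i j k l := by rw [← map_mul, hg.mul_eq]; split_ifs <;> simp
  sum_diag := by rw [← map_sum, hg.sum_diag, map_one]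

theorem reindex (hg : IsMatrixUnits g) (e : κ ≃ ι) : IsMatrixUnits fun i j => g (e i) (e j) where
  star_eq i j := hg.star_eq _ _
  mul_eq i j k l := by simp [hg.mul_eq]
  sum_diag := by rw [e.sum_comp fun i => g i i, hg.sum_diag]

/-- Matrix units `e_{(a,q),(b,r)}` for `M_ι ⊗ M_κ` contain the matrix units of `M_ι ⊗ 1`. -/
theorem sum_prod {g : ι × κ → ι × κ → R} (hg : IsMatrixUnits g) :
    IsMatrixUnits fun i j => ∑ q, g (i, q) (j, q) where
  star_eq i j := by simp [star_sum, hg.star_eq]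
  mul_eq i j k l := by
    simp only [Finset.sum_mul_sum, hg.mul_eq, Prod.mk.injEq]
    split_ifs with h <;> simp [h]
  sum_diag := by rw [← hg.sum_diag, Fintype.sum_prod_type]

theorem matrix_single (K : Type*) [CommSemiring K] [StarRing K] :
    IsMatrixUnits fun i j : ι => Matrix.single i j (1 : K) where
  star_eq i j := by simp [Matrix.star_eq_conjTranspose]
  mul_eq i j k l := by
    split_ifs with h
    · subst h; simp
    · simp [h]
  sum_diag := Matrix.sum_single_one

end Ring

end IsMatrixUnits

/-! ### Amplification and its contraction along matrix units -/

section MatrixAmplification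

attribute [local instance] CStarAlgebra.spectralOrder CStarAlgebra.spectralOrderedRing

section Amplification

variable {A : Type*} [CStarAlgebra A] {n : ℕ}

theorem amplification_apply (a : A) (i j : Fin n) :
    amplification n a i j = if i = j then a else 0 := rfl

theorem continuous_amplification : Continuous (amplification n : A → CStarMatrix (Fin n) (Fin n) A) :=
  continuous_pi fun i => continuous_pi fun j => by
    by_cases h : i = j
    · simp only [amplification_apply, if_pos h]; fun_prop
    · simp only [amplification_apply, if_neg h]; fun_prop

theorem amplification_mul (a b : A) :
    amplification n (a * b) = amplification n a * amplification n b := by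
  ext i j
  simp only [amplification_apply, CStarMatrix.mul_apply, ite_mul, zero_mul, mul_ite, mul_zero,
    Finset.sum_ite_eq', Finset.mem_univ, if_true]

theorem amplification_star (a : A) : amplification n (star a) = star (amplification n a) := by
  ext i j
  by_cases h : i = j
  · simp [amplification_apply, CStarMatrix.star_apply, h]
  · simp [amplification_apply, CStarMatrix.star_apply, h, Ne.symm h]

theorem amplification_one : amplification n (1 : A) = 1 := by
  ext i j; simp [amplification_apply, CStarMatrix.one_apply]

theorem ApproxUnitarilyEquiv.amplify {a b : A} (h : ApproxUnitarilyEquiv a b) :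
    ApproxUnitarilyEquiv (amplification n a) (amplification n b) := by
  obtain ⟨u, hu⟩ := h
  refine ⟨fun k => ⟨amplification n (u k : A), ?_, ?_⟩, ?_⟩
  · rw [← amplification_star, ← amplification_mul, Unitary.star_mul_self_of_mem (u k).2, amplification_one]
  · rw [← amplification_star, ← amplification_mul, Unitary.mul_star_self_of_mem (u k).2, amplification_one]
  · simpa only [← amplification_star, ← amplification_mul, Function.comp_def] using
      (continuous_amplification.tendsto b).comp hu

end Amplification

namespace IsMatrixUnits

variable {A : Type*} [CStarAlgebra A] {n : ℕ}

/-- The linear map `Mₙ(A) → A`, `x ↦ ∑ xᵢⱼ gᵢⱼ`. -/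
def contract (g : Fin n → Fin n → A) : CStarMatrix (Fin n) (Fin n) A →+ A where
  toFun x := ∑ i, ∑ j, x i j * g i j
  map_zero' := by simp
  map_add' x y := by simp [add_mul, Finset.sum_add_distrib]

theorem contract_apply (g : Fin n → Fin n → A) (x : CStarMatrix (Fin n) (Fin n) A) :
    contract g x = ∑ i, ∑ j, x i j * g i j := rfl

variable {g : Fin n → Fin n → A}

theorem contract_amplification (hg : IsMatrixUnits g) (a : A) :
    contract g (amplification n a) = a := by
  simp [contract_apply, amplification_apply, ← Finset.mul_sum, hg.sum_diag]

theorem contract_one (hg : IsMatrixUnits g) : contract g 1 = 1 := by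
  rw [← amplification_one, hg.contract_amplification]

/-- Only the entries of the right factor have to move past matrix units, so nothing is asked of `x`.
-/
theorem contract_mul (hg : IsMatrixUnits g) {x y : CStarMatrix (Fin n) (Fin n) A}
    (hy : ∀ i j k l, Commute (y i j) (g k l)) :
    contract g (x * y) = contract g x * contract g y := by
  have : ∀ i j k l, x i j * g i j * (y k l * g k l) =
      if j = k then x i j * y k l * g i l else 0 := fun i j k l => by
    rw [mul_assoc, ← mul_assoc (g i j), ← (hy k l i j).eq, mul_assoc (y k l), hg.mul_eq]
    split_ifs <;> simp [mul_assoc]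
  simp only [contract_apply, CStarMatrix.mul_apply, Finset.sum_mul, Finset.mul_sum, this]
  simp only [Finset.sum_ite_eq', Finset.mem_univ, if_true]
  rw [Finset.sum_comm]
  refine Eq.trans ?_ Finset.sum_comm
  exact Finset.sum_congr rfl fun l _ => Finset.sum_comm

theorem contract_star (hg : IsMatrixUnits g) {x : CStarMatrix (Fin n) (Fin n) A}
    (hx : ∀ i j k l, Commute (x i j) (g k l)) : contract g (star x) = star (contract g x) := by
  simp only [contract_apply, star_sum, star_mul, hg.star_eq, CStarMatrix.star_apply]
  rw [Finset.sum_comm]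
  refine Finset.sum_congr rfl fun i _ => Finset.sum_congr rfl fun j _ => ?_
  have := congrArg star (hx i j i j).eq
  simpa [hg.star_eq] using this.symm

theorem norm_le_one (hg : IsMatrixUnits g) (i j : Fin n) : ‖g i j‖ ≤ 1 := by
  have hp : IsStarProjection (g j j) :=
    ⟨by simp [IsIdempotentElem, hg.mul_eq], hg.star_eq j j⟩
  have h : ‖g i j‖ * ‖g i j‖ ≤ 1 := by
    rw [← CStarRing.norm_star_mul_self, hg.star_eq, hg.mul_eq, if_pos rfl]
    exact hp.norm_le
  nlinarith [norm_nonneg (g i j)]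

/-- A crude bound suffices: it is uniform in `g`, so the units may vary along a sequence, and it
needs no commutation. -/
theorem norm_contract_le (hg : IsMatrixUnits g) (x : CStarMatrix (Fin n) (Fin n) A) :
    ‖contract g x‖ ≤ (n * n : ℝ) * ‖x‖ := by
  have h : ∀ i j, ‖x i j * g i j‖ ≤ ‖x‖ := fun i j =>
    (norm_mul_le _ _).trans <| (mul_le_of_le_one_right (norm_nonneg _) (hg.norm_le_one i j)).trans
      CStarMatrix.norm_entry_le_norm
  rw [contract_apply]
  refine (norm_sum_le _ _).trans <| (Finset.sum_le_sum fun i _ =>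
    (norm_sum_le _ _).trans <| Finset.sum_le_sum fun j _ => h i j).trans_eq ?_
  simp [mul_assoc]

theorem tendsto_contract {g : ℕ → Fin n → Fin n → A} (hg : ∀ k, IsMatrixUnits (g k))
    {x : ℕ → CStarMatrix (Fin n) (Fin n) A} (hx : Tendsto x atTop (𝓝 0)) :
    Tendsto (fun k => contract (g k) (x k)) atTop (𝓝 0) :=
  squeeze_zero_norm (fun k => (hg k).norm_contract_le (x k))
    (by simpa using (tendsto_norm_zero.comp hx).const_mul (n * n : ℝ))

end IsMatrixUnits

/-! ### Cancelling an amplification -/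

/-- `A` has approximately central matrix units of size `n`: it is the closure of an increasing
sequence of `⋆`-subalgebras, each commuting with some `n × n` matrix units of `A`. -/
def HasApproxCentralMatrixUnits (A : Type*) [CStarAlgebra A] (n : ℕ) : Prop :=
  ∃ S : ℕ → StarSubalgebra ℂ A, Monotone S ∧ Dense (⋃ i, (S i : Set A)) ∧
    ∀ i, ∃ g : Fin n → Fin n → A, IsMatrixUnits g ∧ ∀ x ∈ S i, ∀ k l, Commute x (g k l)

section Cancel

open IsMatrixUnits

variable {A : Type*} [CStarAlgebra A] {n : ℕ}

/-- A matrix has finitely many entries and the `S i` increase, so the pairs with all entries in a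
common `S i` are dense. -/
theorem HasApproxCentralMatrixUnits.exists_approx (hA : HasApproxCentralMatrixUnits A n)
    {U : Set (CStarMatrix (Fin n) (Fin n) A × A)} (hU : IsOpen U) (hne : U.Nonempty) :
    ∃ p ∈ U, ∃ g : Fin n → Fin n → A, IsMatrixUnits g ∧
      (∀ i j k l, Commute (p.1 i j) (g k l)) ∧ ∀ k l, Commute p.2 (g k l) := by
  obtain ⟨S, hm, hd, hg⟩ := hA
  have hd' : Dense (⋃ i, {p : CStarMatrix (Fin n) (Fin n) A × A |
      (∀ k l, p.1 k l ∈ S i) ∧ p.2 ∈ S i}) := by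
    have hpi : Dense (Set.univ.pi fun _ : Fin n => Set.univ.pi fun _ : Fin n =>
        ⋃ i, (S i : Set A)) := dense_pi _ fun _ _ => dense_pi _ fun _ _ => hd
    refine Dense.mono ?_ (hpi.prod hd)
    rintro ⟨y, c⟩ ⟨hy, hc⟩
    have hy' : ∀ k l, ∃ i, y k l ∈ S i := fun k l =>
      Set.mem_iUnion.1 (hy k (Set.mem_univ _) l (Set.mem_univ _))
    choose f hf using hy'
    obtain ⟨i₀, hi₀⟩ := Set.mem_iUnion.1 hc
    refine Set.mem_iUnion.2 ⟨i₀ ⊔ Finset.univ.sup fun p : Fin n × Fin n => f p.1 p.2,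
      fun k l => hm (le_sup_of_le_right ?_) (hf k l), hm le_sup_left hi₀⟩
    exact Finset.le_sup (f := fun p : Fin n × Fin n => f p.1 p.2) (Finset.mem_univ (k, l))
  obtain ⟨p, hpU, hp⟩ := hd'.inter_open_nonempty U hU hne
  obtain ⟨i, hpi⟩ := Set.mem_iUnion.1 hp
  obtain ⟨g, hgu, hgc⟩ := hg i
  exact ⟨p, hpU, g, hgu, fun k l => hgc _ (hpi.1 k l), hgc _ hpi.2⟩

theorem ApproxUnitarilyEquiv.of_amplification (hA : HasApproxCentralMatrixUnits A n) {a b : A}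
    (h : ApproxUnitarilyEquiv (amplification n a) (amplification n b)) :
    ApproxUnitarilyEquiv a b := by
  obtain ⟨u, hu⟩ := h
  let M := CStarMatrix (Fin n) (Fin n) A
  have key : ∀ k : ℕ, ∃ (y : M) (c : A) (g : Fin n → Fin n → A), IsMatrixUnits g ∧
      (∀ i j k l, Commute (y i j) (g k l)) ∧ (∀ k l, Commute c (g k l)) ∧
      ‖star y * y - 1‖ < 1 / ((k : ℝ) + 1) ∧ ‖y * star y - 1‖ < 1 / ((k : ℝ) + 1) ∧
      ‖star y * amplification n c * y - star (u k : M) * amplification n a * (u k : M)‖ <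
        1 / ((k : ℝ) + 1) ∧ ‖a - c‖ < 1 / ((k : ℝ) + 1) := by
    intro k
    have hk : (0 : ℝ) < 1 / ((k : ℝ) + 1) := by positivity
    have hamp : Continuous (amplification n : A → M) := continuous_amplification
    let U : Set (M × A) := {p | ‖star p.1 * p.1 - 1‖ < 1 / ((k : ℝ) + 1) ∧
      ‖p.1 * star p.1 - 1‖ < 1 / ((k : ℝ) + 1) ∧
      ‖star p.1 * amplification n p.2 * p.1 - star (u k : M) * amplification n a * (u k : M)‖ <
        1 / ((k : ℝ) + 1) ∧ ‖a - p.2‖ < 1 / ((k : ℝ) + 1)}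
    have hU : IsOpen U := by
      have c₁ : Continuous fun p : M × A => ‖star p.1 * p.1 - 1‖ := by fun_prop
      have c₂ : Continuous fun p : M × A => ‖p.1 * star p.1 - 1‖ := by fun_prop
      have c₃ : Continuous fun p : M × A => ‖star p.1 * amplification n p.2 * p.1 -
        star (u k : M) * amplification n a * (u k : M)‖ := by fun_prop
      have c₄ : Continuous fun p : M × A => ‖a - p.2‖ := by fun_prop
      exact (isOpen_lt c₁ continuous_const).inter ((isOpen_lt c₂ continuous_const).inter
        ((isOpen_lt c₃ continuous_const).inter (isOpen_lt c₄ continuous_const)))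
    -- The unperturbed pair `(u k, a)` satisfies all four estimates with error `0`.
    have hne : U.Nonempty := by
      refine ⟨((u k : M), a), ?_⟩
      simp only [U, Set.mem_ofPred_eq, Unitary.star_mul_self_of_mem (u k).2,
        Unitary.mul_star_self_of_mem (u k).2, sub_self, norm_zero]
      exact ⟨hk, hk, hk, hk⟩
    obtain ⟨p, ⟨h₁, h₂, h₃, h₄⟩, g, hg, hgy, hgc⟩ := hA.exists_approx hU hne
    exact ⟨p.1, p.2, g, hg, hgy, hgc, h₁, h₂, h₃, h₄⟩
  choose y c g hg hgy hgc h₁ h₂ h₃ h₄ using key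
  have hlim := tendsto_one_div_add_atTop_nhds_zero_nat (𝕜 := ℝ)
  have hgs : ∀ k i j r s, Commute ((star (y k)) i j) (g k r s) := fun k i j r s => by
    have := (hgy k j i s r).star_star
    rwa [(hg k).star_eq] at this
  have e₁ : ∀ k, star (contract (g k) (y k)) * contract (g k) (y k) =
      contract (g k) (star (y k) * y k) := fun k => by
    rw [(hg k).contract_mul (hgy k), (hg k).contract_star (hgy k)]
  have e₂ : ∀ k, contract (g k) (y k) * star (contract (g k) (y k)) =
      contract (g k) (y k * star (y k)) := fun k => by
    rw [(hg k).contract_mul (hgs k), (hg k).contract_star (hgy k)]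
  have e₃ : ∀ k, star (contract (g k) (y k)) * c k * contract (g k) (y k) =
      contract (g k) (star (y k) * amplification n (c k) * y k) := fun k => by
    rw [(hg k).contract_mul (hgy k), (hg k).contract_mul, (hg k).contract_star (hgy k),
      (hg k).contract_amplification]
    intro i j r s
    rw [amplification_apply]
    split_ifs
    exacts [hgc k r s, Commute.zero_left _]
  have t₁ : Tendsto (fun k => star (contract (g k) (y k)) * contract (g k) (y k)) atTop (𝓝 1) := by
    simp only [e₁]
    refine tendsto_sub_nhds_zero_iff.1 ?_
    have := tendsto_contract hg (squeeze_zero_norm (fun k => (h₁ k).le) hlim)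
    simpa only [map_sub, (hg _).contract_one] using this
  have t₂ : Tendsto (fun k => contract (g k) (y k) * star (contract (g k) (y k))) atTop (𝓝 1) := by
    simp only [e₂]
    refine tendsto_sub_nhds_zero_iff.1 ?_
    have := tendsto_contract hg (squeeze_zero_norm (fun k => (h₂ k).le) hlim)
    simpa only [map_sub, (hg _).contract_one] using this
  have t₃ : Tendsto (fun k => star (contract (g k) (y k)) * c k * contract (g k) (y k)) atTop
      (𝓝 b) := by
    simp only [e₃]
    refine tendsto_sub_nhds_zero_iff.1 ?_
    -- `b` need not be perturbed: contraction is additive and recovers `b` from its amplification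
    -- without any commutation.
    have h := (squeeze_zero_norm (fun k => (h₃ k).le) hlim).add (tendsto_sub_nhds_zero_iff.2 hu)
    rw [add_zero] at h
    have := tendsto_contract hg h
    simpa only [sub_add_sub_cancel, map_sub, (hg _).contract_amplification] using this
  -- Replacing `c k` by `a` costs at most `‖w‖² ‖a - c k‖` for the contracted element `w`, and `‖w‖²
  -- = ‖w* w‖ → 1`.
  have t₄ : Tendsto (fun k => star (contract (g k) (y k)) * (a - c k) * contract (g k) (y k)) atTop
      (𝓝 0) := by
    have h : Tendsto (fun k => a - c k) atTop (𝓝 0) := squeeze_zero_norm (fun k => (h₄ k).le) hlim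
    refine squeeze_zero_norm (fun k => ?_) (by simpa using t₁.norm.mul h.norm)
    rw [CStarRing.norm_star_mul_self]
    calc _ ≤ ‖star (contract (g k) (y k))‖ * ‖a - c k‖ * ‖contract (g k) (y k)‖ :=
          (norm_mul_le _ _).trans (mul_le_mul_of_nonneg_right (norm_mul_le _ _) (norm_nonneg _))
      _ = _ := by rw [norm_star]; ring
  refine ApproxUnitarilyEquiv.of_tendsto t₁ t₂ ?_
  simpa only [← add_mul, ← mul_add, add_sub_cancel, add_zero] using t₃.add t₄

end Cancel

end MatrixAmplification

/-! ### Commutants of matrix units in finite dimension -/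

section Commutant

open InnerProductSpace

variable {H : Type*} [NormedAddCommGroup H] [InnerProductSpace ℂ H] [FiniteDimensional ℂ H]
  {κ : Type*} [Fintype κ] [DecidableEq κ]

/-- The commutant of a system of `k × k` matrix units on a finite-dimensional Hilbert space is a
full matrix algebra of size `dim H / k`. -/
theorem IsMatrixUnits.exists_commute_matrixUnits [Nonempty κ] {e : κ → κ → H →L[ℂ] H}
    (he : IsMatrixUnits e) :
    ∃ (r : ℕ) (f : Fin r → Fin r → H →L[ℂ] H), Module.finrank ℂ H = Fintype.card κ * r ∧
      IsMatrixUnits f ∧ ∀ i j s t, Commute (e i j) (f s t) := by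
  obtain ⟨o⟩ := ‹Nonempty κ›
  have hp : IsStarProjection (e o o) :=
    ⟨by simp [IsIdempotentElem, he.mul_eq], he.star_eq o o⟩
  obtain ⟨U, hU, hpU⟩ := isStarProjection_iff_eq_starProjection.1 hp
  let b := stdOrthonormalBasis ℂ U
  set r := Module.finrank ℂ U
  have hsum : ∑ s, rankOne ℂ (b s : H) (b s : H) = e o o := by
    rw [hpU]; exact (b.starProjection_eq_sum_rankOne).symm
  have hfix : ∀ s, e o o (b s : H) = b s := fun s => by
    rw [hpU]; exact Submodule.starProjection_eq_self_iff.2 (b s).2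
  have hfix' : ∀ s t, e o o * rankOne ℂ (b s : H) (b t : H) = rankOne ℂ (b s : H) (b t : H) :=
    fun s t => by ext x; simp [hfix]
  have hrank : ∀ s t s' t', rankOne ℂ (b s : H) (b t : H) * rankOne ℂ (b s' : H) (b t' : H) =
      if t = s' then rankOne ℂ (b s : H) (b t' : H) else 0 := fun s t s' t' => by
    have := orthonormal_iff_ite.1 b.orthonormal t s'
    rw [Submodule.coe_inner] at this
    ext x
    simp only [mul_apply_eq_comp, rankOne_apply, map_smul, this]
    split_ifs <;> simp
  -- `H` is the sum of the ranges of the `e i i`, each identified with `U` through `e i o`; `f s t`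
  -- acts on every copy as the same rank-one operator.
  let f : Fin r → Fin r → H →L[ℂ] H := fun s t =>
    ∑ i, e i o * rankOne ℂ (b s : H) (b t : H) * e o i
  have hef : ∀ i j s t, e i j * f s t = e i o * rankOne ℂ (b s : H) (b t : H) * e o j :=
    fun i j s t => by simp [f, Finset.mul_sum, ← mul_assoc, he.mul_eq, ite_mul]
  have hfe : ∀ i j s t, f s t * e i j = e i o * rankOne ℂ (b s : H) (b t : H) * e o j :=
    fun i j s t => by simp [f, Finset.sum_mul, mul_assoc, he.mul_eq]
  refine ⟨r, f, ?_, ⟨fun s t => ?_, fun s t s' t' => ?_, ?_⟩, fun i j s t => ?_⟩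
  -- The dimension is the trace of `∑ e i i = 1`, and all `e i i` have the trace `r` of `e o o`.
  · have htr : ∀ i, LinearMap.trace ℂ H (e i i) = r := fun i => by
      have h1 : (e i i : H →L[ℂ] H) = e i o * e o i := by simp [he.mul_eq]
      have h2 : (e o o : H →L[ℂ] H) = e o i * e i o := by simp [he.mul_eq]
      have h3 : LinearMap.trace ℂ H (e i i) = LinearMap.trace ℂ H (e o o) := by
        rw [h1, h2]; exact LinearMap.trace_mul_comm ℂ _ _
      rw [h3, ← hsum]
      have : ∀ s, ‖(b s : H)‖ = 1 := b.orthonormal.1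
      simp [trace_rankOne, this]
    have h := congrArg (fun T : H →L[ℂ] H => LinearMap.trace ℂ H T) he.sum_diag
    simp [htr] at h
    exact_mod_cast h.symm
  · simp only [f, star_sum, star_mul, he.star_eq, ContinuousLinearMap.star_eq_adjoint (rankOne _ _ _),
      adjoint_rankOne, mul_assoc]
  · conv_lhs => enter [2]; simp only [f]
    simp only [Finset.mul_sum, ← mul_assoc, hfe]
    have : ∀ i, e i o * rankOne ℂ (b s : H) (b t : H) * e o o * rankOne ℂ (b s' : H) (b t' : H) =
      if t = s' then e i o * rankOne ℂ (b s : H) (b t' : H) else 0 := fun i => by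
      rw [mul_assoc _ (e o o), hfix', mul_assoc, hrank]
      split_ifs <;> simp
    simp only [this, f]
    split_ifs <;> simp
  · simp only [f]
    rw [Finset.sum_comm]
    simp only [← Finset.sum_mul, ← Finset.mul_sum, hsum]
    simp [he.mul_eq, he.sum_diag]
  · rw [Commute, SemiconjBy, hef, hfe]

end Commutant

/-! ### Approximately central matrix units in UHF algebras -/

section UHF

variable {D : Type*} [CStarAlgebra D]

/-- Let `T ≅ M_l` act on `ℂ^l`: the matrix units of `S` have a commutant generated by matrix units
there, which pull back to `T`. -/
theorem StarSubalgebra.exists_matrixUnits_commute_of_le {S T : StarSubalgebra ℂ D} (hST : S ≤ T)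
    {k l : ℕ} (hk : 0 < k) (φ : S ≃⋆ₐ[ℂ] Matrix (Fin k) (Fin k) ℂ)
    (ψ : T ≃⋆ₐ[ℂ] Matrix (Fin l) (Fin l) ℂ) :
    ∃ (r : ℕ) (f : Fin r → Fin r → D), l = k * r ∧ IsMatrixUnits f ∧
      ∀ x ∈ S, ∀ s t, Commute x (f s t) := by
  have : Nonempty (Fin k) := ⟨⟨0, hk⟩⟩
  let L := EuclideanSpace ℂ (Fin l) →L[ℂ] EuclideanSpace ℂ (Fin l)
  let χ : T ≃⋆ₐ[ℂ] L := ψ.trans (Matrix.toEuclideanCLM (n := Fin l) (𝕜 := ℂ))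
  let Φ : Matrix (Fin k) (Fin k) ℂ →⋆ₐ[ℂ] L :=
    (χ : T →⋆ₐ[ℂ] L).comp
      ((StarSubalgebra.inclusion hST).comp (φ.symm : Matrix (Fin k) (Fin k) ℂ →⋆ₐ[ℂ] S))
  let Ψ : L →⋆ₐ[ℂ] D := T.subtype.comp (χ.symm : L →⋆ₐ[ℂ] T)
  have hΨΦ : ∀ x : S, Ψ (Φ (φ x)) = x := fun x => by simp [Ψ, Φ]
  obtain ⟨r, f, hr, hf, hc⟩ :=
    ((IsMatrixUnits.matrix_single (ι := Fin k) ℂ).map Φ).exists_commute_matrixUnits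
  refine ⟨r, fun s t => Ψ (f s t), by simpa using hr, hf.map Ψ, fun x hx s t => ?_⟩
  obtain ⟨m, hm⟩ : ∃ m, Ψ (Φ m) = x := ⟨φ ⟨x, hx⟩, hΨΦ ⟨x, hx⟩⟩
  rw [← hm]
  refine Commute.map ?_ Ψ
  rw [Matrix.matrix_eq_sum_single m, map_sum]
  refine Commute.sum_left _ _ _ fun i _ => ?_
  rw [map_sum]
  refine Commute.sum_left _ _ _ fun j _ => ?_
  have : Matrix.single i j (m i j) = m i j • Matrix.single i j (1 : ℂ) := by simp
  rw [this, map_smul]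
  exact (hc i j s t).smul_left _

/-- Only the finitely many primes dividing `n` need a larger exponent than `k i` provides; take an
index late enough for all of them. -/
theorem exists_mul_dvd_of_iSup_padicValNat_eq_top {k : ℕ → ℕ} (hk : ∀ i, 0 < k i)
    (hdvd : ∀ i j, i ≤ j → k i ∣ k j) {n : ℕ} (hn : 1 ≤ n)
    (hN : ∀ p : Nat.Primes, (p : ℕ) ∣ n → ⨆ i, (padicValNat p (k i) : ℕ∞) = ⊤) (i : ℕ) :
    ∃ j, i ≤ j ∧ k i * n ∣ k j := by
  have hex : ∀ p : ℕ, p ∈ n.primeFactors → ∃ j, padicValNat p (k i * n) ≤ padicValNat p (k j) := by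
    intro p hp
    have hp' := Nat.mem_primeFactors.1 hp
    obtain ⟨j, hj⟩ := iSup_eq_top.1 (hN ⟨p, hp'.1⟩ hp'.2.1)
      (padicValNat p (k i * n) : ℕ∞) (ENat.natCast_lt_top _)
    exact ⟨j, by exact_mod_cast hj.le⟩
  choose! J hJ using hex
  refine ⟨i ⊔ n.primeFactors.sup J, le_sup_left, ?_⟩
  have hle : ∀ a b, a ≤ b → ∀ p, (k a).factorization p ≤ (k b).factorization p := fun a b hab p =>
    (Nat.factorization_le_iff_dvd (hk a).ne' (hk b).ne').2 (hdvd a b hab) p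
  refine (Nat.factorization_prime_le_iff_dvd (Nat.mul_pos (hk i) hn).ne' (hk _).ne').1
    fun p hp => ?_
  by_cases hpn : p ∣ n
  · have hmem : p ∈ n.primeFactors := Nat.mem_primeFactors.2 ⟨hp, hpn, by omega⟩
    refine le_trans ?_ (hle _ _ ((Finset.le_sup hmem).trans le_sup_right) p)
    simpa only [Nat.factorization_def _ hp] using hJ p hmem
  · rw [Nat.factorization_mul (hk i).ne' (by omega), Finsupp.add_apply,
      Nat.factorization_eq_zero_of_not_dvd hpn, add_zero]
    exact hle _ _ le_sup_left p

theorem IsUHF.hasApproxCentralMatrixUnits {N : Supernatural} (hD : IsUHF D N) {n : ℕ} (hn : 1 ≤ n)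
    (hN : ∀ p : Nat.Primes, (p : ℕ) ∣ n → N p = ⊤) : HasApproxCentralMatrixUnits D n := by
  obtain ⟨k, B, hk, hB, hiso, hdense, hsup⟩ := hD
  have key : ∀ i j, i ≤ j → ∃ (r : ℕ) (f : Fin r → Fin r → D), k j = k i * r ∧ IsMatrixUnits f ∧
      ∀ x ∈ B i, ∀ s t, Commute x (f s t) := fun i j hij =>
    StarSubalgebra.exists_matrixUnits_commute_of_le (hB hij) (hk i) (hiso i).some (hiso j).some
  refine ⟨B, hB, hdense, fun i => ?_⟩
  obtain ⟨j, hij, hj⟩ := exists_mul_dvd_of_iSup_padicValNat_eq_top hk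
    (fun i j hij => let ⟨r, _, h, _⟩ := key i j hij; ⟨r, h⟩) hn
    (fun p hp => (hsup p).trans (hN p hp)) i
  obtain ⟨r, f, hr, hf, hc⟩ := key i j hij
  rw [hr] at hj
  obtain ⟨q, rfl⟩ := Nat.dvd_of_mul_dvd_mul_left (hk i) hj
  -- The commuting units have size `n * q`; those of `M_n ⊗ 1` inside `M_n ⊗ M_q` have size `n`.
  exact ⟨_, (hf.reindex finProdFinEquiv).sum_prod, fun x hx s t =>
    Commute.sum_right _ _ _ fun q _ => hc x hx _ _⟩

end UHF

/-! ### Calculus of tensor product operators -/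

section TensorOp

variable {H K : Type*}
  [NormedAddCommGroup H] [InnerProductSpace ℂ H] [NormedAddCommGroup K] [InnerProductSpace ℂ K]

theorem tensorOp_of (S : H →L[ℂ] H) (T : K →L[ℂ] K) (z : H ⊗[ℂ] K) :
    tensorOp S T (HilbertTensor.of z) = HilbertTensor.of (TensorProduct.mapL S T z) :=
  (TensorProduct.mapL S T).completion_apply_coe z

theorem HilbertTensor.denseRange_of :
    DenseRange (HilbertTensor.of : H ⊗[ℂ] K → HilbertTensor H K) :=
  UniformSpace.Completion.denseRange_coe

theorem HilbertTensor.of_add (x y : H ⊗[ℂ] K) :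
    HilbertTensor.of (x + y) = HilbertTensor.of x + HilbertTensor.of y :=
  UniformSpace.Completion.coe_add x y

theorem HilbertTensor.norm_of (x : H ⊗[ℂ] K) : ‖HilbertTensor.of x‖ = ‖x‖ :=
  UniformSpace.Completion.norm_coe x

theorem HilbertTensor.inner_of (x y : H ⊗[ℂ] K) :
    inner ℂ (HilbertTensor.of x) (HilbertTensor.of y) = inner ℂ x y :=
  UniformSpace.Completion.inner_coe x y

theorem HilbertTensor.clm_ext {X Y : HilbertTensor H K →L[ℂ] HilbertTensor H K}
    (h : ∀ z, X (HilbertTensor.of z) = Y (HilbertTensor.of z)) : X = Y :=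
  DFunLike.coe_injective (HilbertTensor.denseRange_of.equalizer X.continuous Y.continuous (funext h))

theorem tensorOp_mul (S S' : H →L[ℂ] H) (T T' : K →L[ℂ] K) :
    tensorOp S T * tensorOp S' T' = tensorOp (S * S') (T * T') :=
  HilbertTensor.clm_ext fun z => by
    rw [mul_apply_eq_comp, tensorOp_of, tensorOp_of, tensorOp_of,
      TensorProduct.mapL_mul]; rfl

theorem tensorOp_one : tensorOp (1 : H →L[ℂ] H) (1 : K →L[ℂ] K) = 1 :=
  HilbertTensor.clm_ext fun z => by
    rw [tensorOp_of]
    exact congrArg _ (DFunLike.congr_fun TensorProduct.mapL_id_id z)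

theorem tensorOp_add_right (S : H →L[ℂ] H) (T T' : K →L[ℂ] K) :
    tensorOp S (T + T') = tensorOp S T + tensorOp S T' :=
  HilbertTensor.clm_ext fun z => by
    rw [add_apply, tensorOp_of, tensorOp_of, tensorOp_of,
      TensorProduct.mapL_add_right, add_apply, HilbertTensor.of_add]

theorem tensorOp_smul_right (c : ℂ) (S : H →L[ℂ] H) (T : K →L[ℂ] K) :
    tensorOp S (c • T) = c • tensorOp S T :=
  HilbertTensor.clm_ext fun z => by
    rw [smul_apply, tensorOp_of, tensorOp_of, TensorProduct.mapL_smul_right,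
      smul_apply]
    exact UniformSpace.Completion.coe_smul c _

theorem norm_tensorOp_le (S : H →L[ℂ] H) (T : K →L[ℂ] K) : ‖tensorOp S T‖ ≤ ‖S‖ * ‖T‖ := by
  refine ContinuousLinearMap.opNorm_le_bound _ (by positivity) fun x => ?_
  refine HilbertTensor.denseRange_of.induction_on x
    (isClosed_le (by fun_prop) (by fun_prop)) fun z => ?_
  rw [tensorOp_of, HilbertTensor.norm_of, HilbertTensor.norm_of]
  exact ContinuousLinearMap.le_of_opNorm_le _ (TensorProduct.norm_mapL_le S T) z

theorem continuous_tensorOp_right (S : H →L[ℂ] H) :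
    Continuous fun T : K →L[ℂ] K => tensorOp S T := by
  refine LipschitzWith.continuous (K := ‖S‖₊) (LipschitzWith.of_dist_le_mul fun T T' => ?_)
  have h : tensorOp S T - tensorOp S T' = tensorOp S (T - T') := by
    rw [sub_eq_iff_eq_add, ← tensorOp_add_right, sub_add_cancel]
  rw [dist_eq_norm, dist_eq_norm, h, coe_nnnorm]
  exact norm_tensorOp_le S _

theorem star_tensorOp [CompleteSpace H] [CompleteSpace K] (S : H →L[ℂ] H) (T : K →L[ℂ] K) :
    star (tensorOp S T) = tensorOp (star S) (star T) := by
  rw [ContinuousLinearMap.star_eq_adjoint, eq_comm, ContinuousLinearMap.eq_adjoint_iff]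
  have h : ∀ x y : H ⊗[ℂ] K, inner ℂ (TensorProduct.mapL (star S) (star T) x) y =
      inner ℂ x (TensorProduct.mapL S T y) := fun x y => by
    induction x with
    | zero => simp
    | add x₁ x₂ h₁ h₂ => rw [map_add, inner_add_left, inner_add_left, h₁, h₂]
    | tmul x₁ x₂ =>
      induction y with
      | zero => simp
      | add y₁ y₂ h₁ h₂ => rw [map_add, inner_add_right, inner_add_right, h₁, h₂]
      | tmul y₁ y₂ =>
        simp [ContinuousLinearMap.star_eq_adjoint, ContinuousLinearMap.adjoint_inner_left]
  intro x y
  refine HilbertTensor.denseRange_of.induction_on₂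
    (p := fun x y => inner ℂ (tensorOp (star S) (star T) x) y = inner ℂ x (tensorOp S T y))
    ?_ (fun x y => ?_) x y
  · exact isClosed_eq (by fun_prop) (by fun_prop)
  · rw [tensorOp_of, tensorOp_of, HilbertTensor.inner_of, HilbertTensor.inner_of, h]

end TensorOp

/-! ### Passage to the spatial tensor product -/

section Spatial

open scoped CStarAlgebra

variable {H K : Type*}
  [NormedAddCommGroup H] [InnerProductSpace ℂ H] [CompleteSpace H]
  [NormedAddCommGroup K] [InnerProductSpace ℂ K] [CompleteSpace K]
  {A D : Type*} [CStarAlgebra A] [CStarAlgebra D]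
  (π : A →⋆ₐ[ℂ] (H →L[ℂ] H)) (σ : D →⋆ₐ[ℂ] (K →L[ℂ] K))

theorem tensorOp_mem_spatialTensor (a : A) (d : D) :
    tensorOp (π a) (σ d) ∈ spatialTensor π σ :=
  StarSubalgebra.le_topologicalClosure _ (StarAlgebra.subset_adjoin ℂ _ ⟨a, d, rfl⟩)

/-- The embedding `d ↦ 1 ⊗ d` of the right factor of the spatial tensor product. -/
noncomputable def spatialTensorRight : D →⋆ₐ[ℂ] spatialTensor π σ where
  toFun d := ⟨tensorOp 1 (σ d), map_one π ▸ tensorOp_mem_spatialTensor π σ 1 d⟩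
  map_one' := Subtype.ext <| by simp [tensorOp_one]
  map_mul' d d' := Subtype.ext <| by simp [tensorOp_mul]
  map_zero' := Subtype.ext <| by simpa using tensorOp_smul_right 0 1 (0 : K →L[ℂ] K)
  map_add' d d' := Subtype.ext <| by simp [tensorOp_add_right]
  commutes' c := Subtype.ext <| by
    simp [Algebra.algebraMap_eq_smul_one, tensorOp_smul_right, tensorOp_one]
  map_star' d := Subtype.ext <| by
    rw [StarMemClass.coe_star, star_tensorOp, star_one, ← map_star]

theorem coe_spatialTensorRight (d : D) :
    (spatialTensorRight π σ d : HilbertTensor H K →L[ℂ] HilbertTensor H K) = tensorOp 1 (σ d) := rfl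

instance isClosed_spatialTensor :
    IsClosed (spatialTensor π σ : Set (HilbertTensor H K →L[ℂ] HilbertTensor H K)) :=
  StarSubalgebra.isClosed_topologicalClosure _

/-- Taking `P i` to be the commutant of `1 ⊗ (S i)'` makes commutation with `1 ⊗ g` automatic; it
contains every `a ⊗ x` with `x ∈ S i`, which gives density. -/
theorem HasApproxCentralMatrixUnits.spatialTensor {n : ℕ} (hD : HasApproxCentralMatrixUnits D n) :
    HasApproxCentralMatrixUnits (spatialTensor π σ) n := by
  obtain ⟨S, hm, hd, hg⟩ := hD
  let P : ℕ → StarSubalgebra ℂ (_root_.spatialTensor π σ) := fun i =>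
    StarSubalgebra.centralizer ℂ (spatialTensorRight π σ '' (StarSubalgebra.centralizer ℂ (S i : Set D)))
  have hP : Monotone P := fun i j hij => StarSubalgebra.centralizer_le ℂ _ _ <|
    Set.image_mono <| StarSubalgebra.centralizer_le ℂ _ _ (hm hij)
  refine ⟨P, hP, ?_, fun i => ?_⟩
  -- The closure of `⋃ P i` is a ⋆-algebra, so it is enough to reach the generators `a ⊗ d`, by
  -- approximating `d` from the `S i`.
  · have hle : _root_.spatialTensor π σ ≤
        (StarSubalgebra.map (_root_.spatialTensor π σ).subtype (⨆ i, P i)).topologicalClosure := by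
      refine StarSubalgebra.topologicalClosure_minimal (StarAlgebra.adjoin_le ?_)
        (StarSubalgebra.isClosed_topologicalClosure _)
      rintro _ ⟨a, d, rfl⟩
      have hcont : Continuous fun d : D => tensorOp (π a) (σ d) :=
        (continuous_tensorOp_right (π a)).comp (map_continuous σ)
      refine closure_mono ?_ (image_closure_subset_closure_image hcont
        (Set.mem_image_of_mem _ (hd d)))
      rintro _ ⟨x, hx, rfl⟩
      obtain ⟨i, hi⟩ := Set.mem_iUnion.1 hx
      refine ⟨⟨_, tensorOp_mem_spatialTensor π σ a x⟩, le_iSup P i ?_, rfl⟩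
      refine StarSubalgebra.mem_centralizer_iff ℂ |>.2 ?_
      rintro _ ⟨z, hz, rfl⟩
      have hcomm : ∀ z ∈ StarSubalgebra.centralizer ℂ (S i : Set D),
          spatialTensorRight π σ z * ⟨_, tensorOp_mem_spatialTensor π σ a x⟩ =
            ⟨_, tensorOp_mem_spatialTensor π σ a x⟩ * spatialTensorRight π σ z := fun z hz => by
        have := (StarSubalgebra.mem_centralizer_iff ℂ |>.1 hz x hi).1
        exact Subtype.ext <| by
          simp [coe_spatialTensorRight, tensorOp_mul, ← map_mul, this]
      refine ⟨hcomm z hz, ?_⟩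
      rw [← map_star]
      exact hcomm _ (star_mem hz)
    intro x
    have := hle x.2
    rw [← SetLike.mem_coe, StarSubalgebra.topologicalClosure_coe, StarSubalgebra.coe_map,
      StarSubalgebra.coe_iSup_of_directed hP.directed_le] at this
    exact closure_subtype.2 this
  · obtain ⟨g, hgu, hgc⟩ := hg i
    refine ⟨_, hgu.map (spatialTensorRight π σ), fun x hx k l => ?_⟩
    refine ((StarSubalgebra.mem_centralizer_iff ℂ |>.1 hx _ ⟨g k l, ?_, rfl⟩).1).symm
    refine StarSubalgebra.mem_centralizer_iff ℂ |>.2 fun x hx => ⟨hgc x hx k l, ?_⟩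
    exact hgc _ (star_mem hx) k l

end Spatial

/-! ### Transport to `A` and conclusion -/

open scoped CStarAlgebra in
theorem HasApproxCentralMatrixUnits.of_starAlgEquiv {A B : Type*} [CStarAlgebra A] [CStarAlgebra B]
    {n : ℕ} (hA : HasApproxCentralMatrixUnits A n) (e : A ≃⋆ₐ[ℂ] B) :
    HasApproxCentralMatrixUnits B n := by
  obtain ⟨S, hm, hd, hg⟩ := hA
  refine ⟨fun i => (S i).map (e : A →⋆ₐ[ℂ] B), fun i j hij => StarSubalgebra.map_mono (hm hij), ?_,
    fun i => ?_⟩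
  · have := e.surjective.denseRange.dense_image (map_continuous e) hd
    rwa [Set.image_iUnion] at this
  · obtain ⟨g, hgu, hgc⟩ := hg i
    refine ⟨_, hgu.map (e : A →⋆ₐ[ℂ] B), ?_⟩
    rintro _ ⟨x, hx, rfl⟩ k l
    exact (hgc x hx k l).map (e : A →⋆ₐ[ℂ] B)

theorem IsStableUnder.approxUnitarilyEquiv_of_amplification {A : Type u} {D : Type v}
    [CStarAlgebra A] [CStarAlgebra D] (hAD : IsStableUnder A D) {N : Supernatural} (hD : IsUHF D N)
    {n : ℕ} (hn : 1 ≤ n) (hN : ∀ p : Nat.Primes, (p : ℕ) ∣ n → N p = ⊤) {a b : A}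
    (h : ApproxUnitarilyEquiv (amplification n a) (amplification n b)) :
    ApproxUnitarilyEquiv a b := by
  obtain ⟨H, _, _, _, K, _, _, _, π, σ, -, -, ⟨e⟩⟩ := hAD
  exact ApproxUnitarilyEquiv.of_amplification
    (((hD.hasApproxCentralMatrixUnits hn hN).spatialTensor π σ).of_starAlgEquiv e) h

theorem corollary4p5 {A : Type u} [CStarAlgebra A] [TopologicalSpace.SeparableSpace A] (a b : A) :
    (∀ (Q : Type v) [CStarAlgebra Q], IsUniversalUHF Q → IsStableUnder A Q →
      List.TFAE
        [ApproxUnitarilyEquiv a b,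
          ∀ n : ℕ, 1 ≤ n → ApproxUnitarilyEquiv (amplification n a) (amplification n b),
          ∃ n : ℕ, 1 ≤ n ∧ ApproxUnitarilyEquiv (amplification n a) (amplification n b)]) ∧
    (∀ (D : Type v) [CStarAlgebra D] (m n : ℕ), 1 ≤ n → m ∣ n →
      IsUHFPow D n → IsStableUnder A D →
      (ApproxUnitarilyEquiv (amplification m a) (amplification m b) ↔
        ApproxUnitarilyEquiv a b)) := by
  refine ⟨fun Q _ hQ hAQ => ?_, fun D _ m n hn hmn hD hAD => ⟨fun h => ?_, fun h => h.amplify⟩⟩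
  · tfae_have 1 → 2 := fun h n _ => h.amplify
    tfae_have 2 → 3 := fun h => ⟨1, le_rfl, h 1 le_rfl⟩
    tfae_have 3 → 1 := fun ⟨n, hn, h⟩ =>
      hAQ.approxUnitarilyEquiv_of_amplification hQ hn (fun _ _ => rfl) h
    tfae_finish
  -- Units of size `m` are needed: primes dividing `m` divide `n`, hence have exponent `∞`.
  · exact hAD.approxUnitarilyEquiv_of_amplification hD (Nat.pos_of_dvd_of_pos hmn hn)
      (fun p hp => if_pos (hp.trans hmn)) h
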